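/- Let $\sigma:\mathbb R\to\mathbb R$ be of class $C^3$ with $\sigma(\theta)\ge\sigma(0)>0$ and $\sigma'(\theta)\,\theta\ge 0$ for all $\theta$, $\sigma''(0)>0$, and $\sigma'(\theta)=0$ if and only if $\theta=0$. Let $\gamma,\eta>0$, and let $x^{(1)},x^{(2)},x^{(3)}\in\mathbb R^2$ satisfy $$\Bigl|\sum_{j\ne i}\frac{x^{(j)}-x^{(i)}}{|x^{(j)}-x^{(i)}|}\Bigr|>1\qquad(i=1,2,3).$$ Let $a_\infty\in\mathbb R^2$ be the solution of $\sum_{j=1}^3 b_\infty^{(j)}/|b_\infty^{(j)}|=0$, where $b_\infty^{(j)}=x^{(j)}-a_\infty\neq0$. For $\alpha:[0,\infty)\to\mathbb R^3$ and $a:[0,\infty)\to\mathbb R^2$ put $\Delta^{(j)}\alpha=\alpha^{(j-1)}-\alpha^{(j)}$ (indices modulo $3$) and $b^{(j)}=x^{(j)}-a$, and consider the system $$\frac{d\alpha^{(j)}}{dt}=-\gamma\Bigl(\sigma'(\Delta^{(j+1)}\alpha)\,|b^{(j+1)}|-\sigma'(\Delta^{(j)}\alpha)\,|b^{(j)}|\Bigr)\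 (j=1,2,3),\qquad \frac{da}{dt}=\eta\sum_{j=1}^3\sigma(\Delta^{(j)}\alpha)\frac{b^{(j)}}{|b^{(j)}|}\qquad(t>0)$$ with initial data $\alpha(0)=\alpha_0$, $a(0)=a_0$ (solutions are continuous on $[0,\infty)$ with $b^{(j)}(t)\ne0$ for all $t \ge 0$ and all $j$). Let $\vec\alpha_\infty=\frac13(\alpha_0^{(1)}+\alpha_0^{(2)}+\alpha_0^{(3)})(1,1,1)$, and let $$E(t)=\sum_{j=1}^3\sigma(\Delta^{(j)}\alpha(t))\,|b^{(j)}(t)|,\qquad E_\infty=\sigma(0)\sum_{j=1}^3|b_\infty^{(j)}|.$$ Let $\lambda=\min\{\gamma\sigma''(0)\lambda_1,\ \eta\sigma(0)\lambda_2\}$, where $$\lambda_1=\sum_{j=1}^3|b_\infty^{(j)}|-\sqrt{\tfrac12\sum_{j=1}^3\bigl(|b_\infty^{(j)}|-|b_\infty^{(j+1)}|\bigr)^2}$$ and $\lambda_2$ is the smallest eigenvalue of $$L=\sum_{j=1}^3\frac1{|b_\infty^{(j)}|}\Bigl(I-\frac{b_\infty^{(j)}}{|b_\infty^{(j)}|}\otimes\frac{b_\infty^{(j)}}{|b_\infty^{(j)}|}\Bigr).$$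 Then there are constants $\varepsilon,C,C',\lambda^\star>0$ with $\lambda^\star\ge\lambda$, depending only on $\sigma,\gamma,\eta,x^{(1)},x^{(2)},x^{(3)}$, such that for all initial data with $|\alpha_0-\vec\alpha_\infty|+|a_0-a_\infty|<\varepsilon$ the system has a unique global solution $(\alpha,a)$, and for all $t\ge0$ $$|\alpha(t)-\vec\alpha_\infty|+|a(t)-a_\infty|\le C e^{-\lambda^\star t}\qquad\text{and}\qquad E(t)-E_\infty\le C' e^{-\lambda^\star t}.$$ -/

import Mathlib

noncomputable section

namespace GrainBoundary

/-- The plane `ℝ²` with its Euclidean norm. -/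
abbrev Plane : Type := EuclideanSpace ℝ (Fin 2)

/-- Triples of grain orientations, with the Euclidean norm of `ℝ³`. The three grains and the three
boundaries are indexed by `Fin 3`, whose arithmetic is modulo `3`. -/
abbrev Orient : Type := EuclideanSpace ℝ (Fin 3)

/-- The standing assumptions on the surface tension `σ`: it is of class `C³`, positive and
minimized at `0`, `σ'(θ) θ ≥ 0`, `σ''(0) > 0`, and `σ'` vanishes exactly at `0`. -/
structure IsSurfaceTension (σ : ℝ → ℝ) : Prop where
  contDiff : ContDiff ℝ 3 σ
  zero_le : ∀ θ, σ 0 ≤ σ θ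
  zero_pos : 0 < σ 0
  deriv_mul_nonneg : ∀ θ, 0 ≤ deriv σ θ * θ
  deriv2_pos : 0 < deriv (deriv σ) 0
  deriv_eq_zero_iff : ∀ θ, deriv σ θ = 0 ↔ θ = 0

/-- The unit vector `v / |v|` (it is used for `v ≠ 0` only). -/
def unit (v : Plane) : Plane := ‖v‖⁻¹ • v

/-- The misorientation `Δ⁽ʲ⁾α = α⁽ʲ⁻¹⁾ - α⁽ʲ⁾` (cyclic indices). -/
def misorient (α : Orient) (j : Fin 3) : ℝ := α (j - 1) - α j

/-- The angle condition on the three fixed end points: for every `i`,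
`|∑_{j ≠ i} (x⁽ʲ⁾ - x⁽ⁱ⁾) / |x⁽ʲ⁾ - x⁽ⁱ⁾|| > 1`. -/
def AngleCondition (x : Fin 3 → Plane) : Prop :=
  ∀ i, 1 < ‖∑ j ∈ Finset.univ.erase i, unit (x j - x i)‖

/-- `a∞` solves the equilibrium system: with `b∞⁽ʲ⁾ = x⁽ʲ⁾ - a∞ ≠ 0`, the unit vectors
`b∞⁽ʲ⁾ / |b∞⁽ʲ⁾|` sum to zero. -/
def IsEquilibrium (x : Fin 3 → Plane) (aInf : Plane) : Prop :=
  (∀ j, x j - aInf ≠ 0) ∧ ∑ j, unit (x j - aInf) = 0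

/-- The right-hand side of the orientation equation:
`-γ (σ'(Δ⁽ʲ⁺¹⁾α) |b⁽ʲ⁺¹⁾| - σ'(Δ⁽ʲ⁾α) |b⁽ʲ⁾|)` with `b⁽ʲ⁾ = x⁽ʲ⁾ - a`. -/
def orientField (σ : ℝ → ℝ) (γ : ℝ) (x : Fin 3 → Plane) (α : Orient) (a : Plane) : Orient :=
  WithLp.toLp 2 fun j =>
    -γ * (deriv σ (misorient α (j + 1)) * ‖x (j + 1) - a‖
      - deriv σ (misorient α j) * ‖x j - a‖)

/-- The right-hand side of the triple junction equation: `η ∑ⱼ σ(Δ⁽ʲ⁾α) b⁽ʲ⁾ / |b⁽ʲ⁾|` with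
`b⁽ʲ⁾ = x⁽ʲ⁾ - a`. -/
def junctionField (σ : ℝ → ℝ) (η : ℝ) (x : Fin 3 → Plane) (α : Orient) (a : Plane) : Plane :=
  η • ∑ j, σ (misorient α j) • unit (x j - a)

/-- `(α, a)` is a global (classical) solution with initial data `(α₀, a₀)`: continuous on `[0, ∞)`,
the junction never meets an end point, and both equations hold for all `t > 0`. Values at negative
times are irrelevant. -/
structure IsGlobalSolution (σ : ℝ → ℝ) (γ η : ℝ) (x : Fin 3 → Plane) (α₀ : Orient) (a₀ : Plane)
    (α : ℝ → Orient) (a : ℝ → Plane) : Prop where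
  init_orient : α 0 = α₀
  init_junction : a 0 = a₀
  cont_orient : ContinuousOn α (Set.Ici 0)
  cont_junction : ContinuousOn a (Set.Ici 0)
  ne_endpoint : ∀ t, 0 ≤ t → ∀ j, x j - a t ≠ 0
  eq_orient : ∀ t, 0 < t → HasDerivAt α (orientField σ γ x (α t) (a t)) t
  eq_junction : ∀ t, 0 < t → HasDerivAt a (junctionField σ η x (α t) (a t)) t

/-- The total grain boundary energy `∑ⱼ σ(Δ⁽ʲ⁾α) |b⁽ʲ⁾|`, `b⁽ʲ⁾ = x⁽ʲ⁾ - a`. -/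
def energy (σ : ℝ → ℝ) (x : Fin 3 → Plane) (α : Orient) (a : Plane) : ℝ :=
  ∑ j, σ (misorient α j) * ‖x j - a‖

/-- The equilibrium energy `E∞ = σ(0) ∑ⱼ |b∞⁽ʲ⁾|`, `b∞⁽ʲ⁾ = x⁽ʲ⁾ - a∞`. -/
def energyInf (σ : ℝ → ℝ) (x : Fin 3 → Plane) (aInf : Plane) : ℝ :=
  σ 0 * ∑ j, ‖x j - aInf‖

/-- The equilibrium orientation `α∞ (1, 1, 1)`, where `α∞` is the mean of the initial
orientations. -/
def orientInf (α₀ : Orient) : Orient := WithLp.toLp 2 fun _ => (∑ j, α₀ j) / 3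

/-- The rate `λ₁`, the smallest positive eigenvalue of the matrix of the linearized orientation
equation, in explicit form. -/
def rateOne (x : Fin 3 → Plane) (aInf : Plane) : ℝ :=
  (∑ j, ‖x j - aInf‖) -
    √((1 / 2) * ∑ j, (‖x j - aInf‖ - ‖x (j + 1) - aInf‖) ^ 2)

/-- The operator `L = ∑ⱼ |b∞⁽ʲ⁾|⁻¹ (I - u⁽ʲ⁾ ⊗ u⁽ʲ⁾)`, `u⁽ʲ⁾ = b∞⁽ʲ⁾ / |b∞⁽ʲ⁾|`, of the
linearized triple junction equation. -/
def junctionOp (x : Fin 3 → Plane) (aInf : Plane) : Plane →ₗ[ℝ] Plane :=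
  ∑ j, ‖x j - aInf‖⁻¹ •
    (LinearMap.id - (innerₛₗ ℝ (unit (x j - aInf))).smulRight (unit (x j - aInf)))

/-- The rate `λ₂`, the smallest eigenvalue of the operator `L` above. -/
def rateTwo (x : Fin 3 → Plane) (aInf : Plane) : ℝ :=
  sInf {μ : ℝ | Module.End.HasEigenvalue (junctionOp x aInf) μ}

/-- The rate `λ = min {γ σ''(0) λ₁, η σ(0) λ₂}`. -/
def rate (σ : ℝ → ℝ) (γ η : ℝ) (x : Fin 3 → Plane) (aInf : Plane) : ℝ :=
  min (γ * deriv (deriv σ) 0 * rateOne x aInf) (η * σ 0 * rateTwo x aInf)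

end GrainBoundary

end

/-! The orientations enter only through their differences and their sum is conserved, so subtracting
the mean moves every nearby problem to one fixed equilibrium `(0, aInf)` on the zero-sum subspace.
There `σ'(0) = 0` makes the linearization block diagonal: a weighted triangle Laplacian on the
orientations, bounded below by `rateOne` (`triangle_form_ge`), and `junctionOp` on the junction,
bounded below by `rateTwo`. Both blocks are symmetric, so the linear part dissipates the squared
Euclidean distance `y` at rate `2λ` (`inner_fderiv_field_le`).

Since `σ'` is `C²`, the Taylor remainder of the field is quadratic, whence `y' ≤ -2λy + Cy^(3/2)`
near the equilibrium. For small data this gives decay first at half the rate; then `√y` is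
integrable in time and the nonlinear term costs only a constant factor (`exp_decay_of_deriv_le`).
Hence `λ* = λ` is attained.

The field is singular at the end points, so a solution is built for a bounded Lipschitz cutoff. The
decay estimate traps it where the cutoff equals `1`; the same estimate traps every competing
solution, which gives uniqueness. -/

open Set Filter Topology
open scoped NNReal RealInnerProductSpace

/-! ### Taylor remainder and scalar differential inequalities -/

/-- Second order Taylor estimate at a point of `C²` regularity. -/
theorem ContDiffAt.exists_norm_sub_sub_fderiv_le {E F : Type*}
    [NormedAddCommGroup E] [NormedSpace ℝ E] [NormedAddCommGroup F] [NormedSpace ℝ F]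
    {f : E → F} {p : E} (hf : ContDiffAt ℝ 2 f p) :
    ∃ K : ℝ, 0 ≤ K ∧ ∀ᶠ z in 𝓝 p, ‖f z - f p - fderiv ℝ f p (z - p)‖ ≤ K * ‖z - p‖ ^ 2 := by
  obtain ⟨K, t, ht, hK⟩ :=
    (hf.fderiv_right (m := 1) (by norm_num)).exists_lipschitzOnWith
  obtain ⟨r, hr, hrs⟩ := Metric.eventually_nhds_iff_ball.1
    ((hf.eventually (by simp)).and ht)
  refine ⟨K, K.2, Metric.eventually_nhds_iff_ball.2 ⟨r, hr, fun z hz => ?_⟩⟩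
  have hz' : ‖z - p‖ < r := by simpa [dist_eq_norm] using hz
  have hsub : Metric.closedBall p ‖z - p‖ ⊆ Metric.ball p r :=
    Metric.closedBall_subset_ball hz'
  have hp : p ∈ t := (hrs p (Metric.mem_ball_self hr)).2
  -- Mean value inequality on the closed ball of radius `‖z - p‖`, where the derivative differs from
  -- its value at `p` by at most `K * ‖z - p‖`.
  have := (convex_closedBall p ‖z - p‖).norm_image_sub_le_of_norm_fderiv_le' (𝕜 := ℝ)
    (f := f) (φ := fderiv ℝ f p) (C := K * ‖z - p‖) (x := p) (y := z)
    (fun w hw => (hrs w (hsub hw)).1.differentiableAt (by simp))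
    (fun w hw => by
      refine (hK.norm_sub_le (hrs w (hsub hw)).2 hp).trans ?_
      have : ‖w - p‖ ≤ ‖z - p‖ := by simpa [dist_eq_norm] using hw
      gcongr)
    (Metric.mem_closedBall_self (norm_nonneg _)) (by simp [dist_eq_norm])
  simpa [pow_two, mul_assoc] using this

/-- A differential inequality `y' ≤ -g' y` makes `y exp g` nonincreasing. -/
theorem mul_exp_le_of_deriv_le {y y' g g' : ℝ → ℝ} (hy : ContinuousOn y (Ici 0))
    (hd : ∀ t, 0 < t → HasDerivAt y (y' t) t) (hg : ∀ t, HasDerivAt g (g' t) t)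
    (h : ∀ t, 0 < t → y' t ≤ -g' t * y t) {t : ℝ} (ht : 0 ≤ t) :
    y t * Real.exp (g t) ≤ y 0 * Real.exp (g 0) := by
  have hder : ∀ s, 0 < s → HasDerivAt (fun s => y s * Real.exp (g s))
      (y' s * Real.exp (g s) + y s * (Real.exp (g s) * g' s)) s :=
    fun s hs => (hd s hs).mul (hg s).exp
  have hgc : Continuous g := continuous_iff_continuousAt.2 fun s => (hg s).continuousAt
  have hanti : AntitoneOn (fun s => y s * Real.exp (g s)) (Ici 0) := by
    refine antitoneOn_of_deriv_nonpos (convex_Ici 0)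
      (hy.mul (Real.continuous_exp.comp hgc).continuousOn) ?_ ?_
    · intro s hs
      rw [interior_Ici] at hs
      exact (hder s hs).differentiableAt.differentiableWithinAt
    · intro s hs
      rw [interior_Ici] at hs
      rw [(hder s hs).deriv]
      nlinarith [h s hs, Real.exp_pos (g s)]
  exact hanti self_mem_Ici ht ht

/-- Barrier argument: a function that decreases whenever it equals `δ` stays below `δ`. -/
theorem le_of_deriv_neg_of_eq {y y' : ℝ → ℝ} {δ : ℝ} (hy : ContinuousOn y (Ici 0))
    (hd : ∀ t, 0 < t → HasDerivAt y (y' t) t) (h0 : y 0 < δ)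
    (h : ∀ t, 0 < t → y t = δ → y' t < 0) {t : ℝ} (ht : 0 ≤ t) : y t ≤ δ := by
  rcases ht.eq_or_lt with rfl | ht
  · exact h0.le
  -- No derivative is given at `0`, so the barrier comparison starts at a small `s > 0`.
  have hev : ∀ᶠ s in 𝓝[>] (0 : ℝ), y s < δ :=
    ((hy 0 self_mem_Ici).mono Ioi_subset_Ici_self).eventually_lt_const h0
  obtain ⟨s, hs, hs0⟩ := (hev.and (Ioo_mem_nhdsGT ht)).exists
  refine image_le_of_deriv_right_lt_deriv_boundary (a := s) (b := t) (B := fun _ => δ)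
    (B' := fun _ => 0) (f' := y') (hy.mono fun w hw => hs0.1.le.trans hw.1)
    (fun w hw => (hd w (hs0.1.trans_le hw.1)).hasDerivWithinAt) hs.le
    (fun w => hasDerivAt_const w δ) (fun w hw => h w (hs0.1.trans_le hw.1))
    (right_mem_Icc.2 hs0.2.le)

/-- Exponential decay with the exact linear rate for `y' ≤ -2 l y + 2 K y ^ (3 / 2)` and small
initial values. -/
theorem exp_decay_of_deriv_le {y y' : ℝ → ℝ} {l K δ : ℝ} (hy : ContinuousOn y (Ici 0))
    (hy0 : ∀ t, 0 ≤ t → 0 ≤ y t) (hd : ∀ t, 0 < t → HasDerivAt y (y' t) t)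
    (hl : 0 < l) (hK : 0 ≤ K) (hδ : 0 < δ) (hsmall : K * √δ ≤ l / 2)
    (h : ∀ t, 0 < t → y t ≤ δ → y' t ≤ -2 * l * y t + 2 * K * (y t * √(y t)))
    (h0 : y 0 < δ) {t : ℝ} (ht : 0 ≤ t) :
    y t ≤ δ ∧ y t ≤ δ * Real.exp (4 * K * √δ / l) * Real.exp (-2 * l * t) := by
  -- Below `δ` the superlinear term absorbs at most half of the linear decay.
  have hhalf : ∀ s, 0 < s → y s ≤ δ → y' s ≤ -l * y s := by
    intro s hs hys
    have h1 : K * √(y s) ≤ l / 2 :=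
      (mul_le_mul_of_nonneg_left (Real.sqrt_le_sqrt hys) hK).trans hsmall
    nlinarith [h s hs hys, hy0 s hs.le]
  have hle : ∀ s, 0 ≤ s → y s ≤ δ := fun s hs =>
    le_of_deriv_neg_of_eq hy hd h0
      (fun w hw hyw => by nlinarith [hhalf w hw hyw.le, mul_pos hl hδ]) hs
  have hslow : ∀ s, 0 ≤ s → y s ≤ δ * Real.exp (-l * s) := by
    intro s hs
    have := mul_exp_le_of_deriv_le (g := fun s => l * s) (g' := fun _ => l) hy hd
      (fun w => by simpa using (hasDerivAt_id w).const_mul l)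
      (fun w hw => hhalf w hw (hle w hw.le)) hs
    simp only [mul_zero, Real.exp_zero, mul_one] at this
    calc y s = y s * Real.exp (l * s) * Real.exp (-l * s) := by
          rw [mul_assoc, ← Real.exp_add]; simp
      _ ≤ δ * Real.exp (-l * s) := by gcongr; exact this.trans h0.le
  have hsqrt : ∀ s, 0 ≤ s → √(y s) ≤ √δ * Real.exp (-(l / 2) * s) := by
    intro s hs
    refine Real.sqrt_le_iff.2 ⟨by positivity, (hslow s hs).trans_eq ?_⟩
    rw [mul_pow, Real.sq_sqrt hδ.le, ← Real.exp_nat_mul]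
    congr 2
    push_cast
    ring
  refine ⟨hle t ht, ?_⟩
  set c := 4 * K * √δ / l with hc
  have hc0 : 0 ≤ c := by positivity
  -- The bound on `√y` turns the inequality into a linear one with coefficient `g'`. Its
  -- perturbation is integrable, with total mass `c`, so the full rate survives.
  have := mul_exp_le_of_deriv_le (g := fun s => 2 * l * s + c * Real.exp (-(l / 2) * s))
    (g' := fun s => 2 * l - 2 * K * (√δ * Real.exp (-(l / 2) * s))) hy hd
    (fun w => by
      have h1 : HasDerivAt (fun s : ℝ => -(l / 2) * s) (-(l / 2)) w := by
        simpa using (hasDerivAt_id w).const_mul (-(l / 2))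
      have h2 : HasDerivAt (fun s : ℝ => 2 * l * s) (2 * l) w := by
        simpa using (hasDerivAt_id w).const_mul (2 * l)
      convert! h2.add (h1.exp.const_mul c) using 1
      rw [hc]
      field_simp
      ring)
    (fun w hw => by
      have h1 := h w hw (hle w hw.le)
      have h2 := mul_le_mul_of_nonneg_left
        (mul_le_mul_of_nonneg_left (hsqrt w hw.le) (hy0 w hw.le)) hK
      nlinarith) ht
  simp only [mul_zero, Real.exp_zero, mul_one, zero_add] at this
  calc y t = y t * Real.exp (2 * l * t) * Real.exp (-2 * l * t) := by
        rw [mul_assoc, ← Real.exp_add]; simp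
    _ ≤ y t * Real.exp (2 * l * t + c * Real.exp (-(l / 2) * t)) * Real.exp (-2 * l * t) := by
        gcongr
        · exact hy0 t ht
        · have := Real.exp_pos (-(l / 2) * t)
          nlinarith
    _ ≤ δ * Real.exp c * Real.exp (-2 * l * t) := by
        refine mul_le_mul_of_nonneg_right ?_ (Real.exp_pos _).le
        exact this.trans (mul_le_mul_of_nonneg_right h0.le (Real.exp_pos c).le)

/-! ### Autonomous differential equations and cutoffs -/

section ODE

variable {E : Type*} [NormedAddCommGroup E] [NormedSpace ℝ E]

/-- A solution on `(0, ∞)` that is continuous at `0` has a right derivative there. -/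
theorem hasDerivWithinAt_Ici_of_solution {f : E → E} {z : ℝ → E} (hz : ContinuousOn z (Ici 0))
    (hd : ∀ t, 0 < t → HasDerivAt z (f (z t)) t) (hf : ContinuousAt f (z 0)) {t : ℝ}
    (ht : 0 ≤ t) : HasDerivWithinAt z (f (z t)) (Ici t) t := by
  rcases ht.eq_or_lt with rfl | ht
  · have hz0 : ContinuousWithinAt z (Ioi 0) 0 := (hz 0 self_mem_Ici).mono Ioi_subset_Ici_self
    refine hasDerivWithinAt_Ici_of_tendsto_deriv (s := Ioi 0)
      (fun s hs => (hd s hs).differentiableAt.differentiableWithinAt) hz0 self_mem_nhdsWithin ?_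
    refine (hf.tendsto.comp hz0).congr' ?_
    filter_upwards [self_mem_nhdsWithin] with s hs
    exact (hd s hs).deriv.symm
  · exact (hd t ht).hasDerivWithinAt

/-- Uniqueness forward in time for solutions that stay in a set where the field is Lipschitz. -/
theorem eq_of_solution_of_lipschitzOnWith {f : E → E} {K : ℝ≥0} {s : Set E}
    (hf : LipschitzOnWith K f s) {z w : ℝ → E} (hz : ContinuousOn z (Ici 0))
    (hzd : ∀ t, 0 < t → HasDerivAt z (f (z t)) t) (hzs : ∀ t, 0 ≤ t → z t ∈ s)
    (hw : ContinuousOn w (Ici 0)) (hwd : ∀ t, 0 < t → HasDerivAt w (f (w t)) t)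
    (hws : ∀ t, 0 ≤ t → w t ∈ s) (h0 : z 0 = w 0) (hf0 : ContinuousAt f (z 0)) {t : ℝ}
    (ht : 0 ≤ t) : z t = w t :=
  ODE_solution_unique_of_mem_Icc_right (v := fun _ => f) (s := fun _ => s) (a := 0) (b := t)
    (fun _ _ => hf) (hz.mono Icc_subset_Ici_self)
    (fun _ h => hasDerivWithinAt_Ici_of_solution hz hzd hf0 h.1) (fun r h => hzs r h.1)
    (hw.mono Icc_subset_Ici_self)
    (fun _ h => hasDerivWithinAt_Ici_of_solution hw hwd (h0 ▸ hf0) h.1) (fun r h => hws r h.1) h0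
    (right_mem_Icc.2 ht)

/-- A bounded Lipschitz autonomous field has global solutions. -/
theorem exists_global_solution_of_lipschitzWith [CompleteSpace E] {f : E → E} {K L : ℝ≥0}
    (hf : LipschitzWith K f) (hL : ∀ z, ‖f z‖ ≤ L) (z₀ : E) :
    ∃ z : ℝ → E, z 0 = z₀ ∧ ∀ t, HasDerivAt z (f (z t)) t := by
  have hloc : ∀ n : ℕ, ∃ z : ℝ → E, z 0 = z₀ ∧
      ∀ t ∈ Ioo (-((n : ℝ) + 1)) (n + 1), HasDerivAt z (f (z t)) t := by
    intro n
    have hn : (0 : ℝ) < n + 1 := by positivity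
    -- In time `n + 1` a solution of speed at most `L` travels at most `L * (n + 1)`, hence this
    -- radius.
    have hP : IsPicardLindelof (fun _ => f) (tmin := -((n : ℝ) + 1)) (tmax := n + 1)
        ⟨0, by constructor <;> linarith⟩ z₀ (L * (n + 1)) 0 L K :=
      IsPicardLindelof.of_time_independent (fun z _ => hL z) hf.lipschitzOnWith (by simp)
    obtain ⟨z, hz0, hz⟩ := hP.exists_eq_forall_mem_Icc_hasDerivWithinAt₀
    exact ⟨z, hz0, fun t ht => (hz t (Ioo_subset_Icc_self ht)).hasDerivAt
      (Icc_mem_nhds ht.1 ht.2)⟩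
  choose Z hZ0 hZ using hloc
  have hagree : ∀ m n : ℕ, m ≤ n → EqOn (Z m) (Z n) (Ioo (-((m : ℝ) + 1)) (m + 1)) := by
    intro m n hmn
    have hmn' : (m : ℝ) ≤ n := by exact_mod_cast hmn
    have hm : (0 : ℝ) ≤ m := by positivity
    refine ODE_solution_unique_of_mem_Ioo (v := fun _ => f) (s := fun _ => univ) (t₀ := 0)
      (fun _ _ => hf.lipschitzOnWith) ⟨by linarith, by linarith⟩
      (fun t ht => ⟨hZ m t ht, mem_univ _⟩)
      (fun t ht => ⟨hZ n t ⟨by linarith [ht.1], by linarith [ht.2]⟩, mem_univ _⟩) ?_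
    rw [hZ0, hZ0]
  -- The local solutions are glued; the margin `+ 1` in their intervals keeps `t` in the interior.
  refine ⟨fun t => Z ⌈|t|⌉₊ t, by simp [hZ0], fun t => ?_⟩
  set N := ⌈|t|⌉₊ + 1 with hN
  have hmem : ∀ s : ℝ, s ∈ Ioo (-((⌈|s|⌉₊ : ℝ) + 1)) (⌈|s|⌉₊ + 1) := by
    intro s
    have h1 := abs_le.1 (Nat.le_ceil |s|)
    exact ⟨by linarith [h1.1], by linarith [h1.2]⟩
  have hev : (fun s => Z ⌈|s|⌉₊ s) =ᶠ[𝓝 t] Z N := by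
    have : ∀ᶠ s : ℝ in 𝓝 t, |s| < (N : ℝ) := by
      refine continuous_abs.continuousAt.eventually_lt_const ?_
      rw [hN]
      push_cast
      linarith [Nat.le_ceil |t|]
    filter_upwards [this] with s hs
    exact hagree _ _ (Nat.ceil_le.2 hs.le) (hmem s)
  have ht : t ∈ Ioo (-((N : ℝ) + 1)) (N + 1) := by
    have := hmem t
    rw [hN]
    push_cast
    exact ⟨by linarith [this.1], by linarith [this.2]⟩
  have h1 := (hZ N t ht).congr_of_eventuallyEq hev
  rwa [← hev.eq_of_nhds] at h1

/-- A field that is `C¹` near a point agrees near it with a bounded Lipschitz multiple of itself. -/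
theorem ContDiffAt.exists_cutoff_smul [FiniteDimensional ℝ E] {f : E → E} {p : E}
    (hf : ContDiffAt ℝ 1 f p) :
    ∃ r > 0, ∃ χ : E → ℝ, (∀ z ∈ Metric.closedBall p r, χ z = 1) ∧
      ∃ K L : ℝ≥0, LipschitzWith K (fun z => χ z • f z) ∧ ∀ z, ‖χ z • f z‖ ≤ L := by
  obtain ⟨r, hr, hfr⟩ := Metric.eventually_nhds_iff_ball.1 (hf.eventually (by simp))
  let χ : ContDiffBump p := ⟨r / 4, r / 2, by positivity, by linarith⟩
  have hcd : ContDiff ℝ 1 (fun z => χ z • f z) := by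
    refine contDiff_iff_contDiffAt.2 fun z => ?_
    by_cases hz' : z ∈ tsupport χ
    swap
    · refine (contDiffAt_const (c := (0 : E))).congr_of_eventuallyEq ?_
      filter_upwards [notMem_tsupport_iff_eventuallyEq.1 hz'] with w hw
      simp [hw]
    rw [χ.tsupport_eq] at hz'
    exact χ.contDiffAt.smul (hfr z (Metric.closedBall_subset_ball (by simp [χ]; linarith) hz'))
  have hcs : HasCompactSupport (fun z => χ z • f z) := χ.hasCompactSupport.smul_right
  obtain ⟨K, hK⟩ := ContDiff.lipschitzWith_of_hasCompactSupport hcs hcd (by simp)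
  obtain ⟨L, hL⟩ := hcd.continuous.bounded_above_of_compact_support hcs
  exact ⟨r / 4, by positivity, χ, fun z hz => χ.one_of_mem_closedBall hz, K, L.toNNReal, hK,
    fun z => (hL z).trans (Real.le_coe_toNNReal L)⟩

end ODE

namespace GrainBoundary

/-! ### Coercivity of the linearized operators -/

/-- The quadratic form of the weighted Laplacian of a triangle on zero-sum vectors. -/
theorem triangle_form_ge {w₀ w₁ w₂ a b c : ℝ} (h : a + b + c = 0) :
    ((w₀ + w₁ + w₂) - √((1 / 2) * ((w₀ - w₁) ^ 2 + (w₁ - w₂) ^ 2 + (w₂ - w₀) ^ 2))) *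
        (a ^ 2 + b ^ 2 + c ^ 2)
      ≤ w₀ * (c - a) ^ 2 + w₁ * (a - b) ^ 2 + w₂ * (b - c) ^ 2 := by
  obtain rfl : c = -a - b := by linarith
  set Q := (1 / 2) * ((w₀ - w₁) ^ 2 + (w₁ - w₂) ^ 2 + (w₂ - w₀) ^ 2) with hQ
  set N := a ^ 2 + b ^ 2 + (-a - b) ^ 2 with hN
  set A := w₀ * (-a - b - a) ^ 2 + w₁ * (a - b) ^ 2 + w₂ * (b - (-a - b)) ^ 2 with hA
  have hN0 : 0 ≤ N := by positivity
  have hQ0 : 0 ≤ Q := by positivity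
  have key : (w₀ + w₁ + w₂) * N - A ≤ √(Q * N ^ 2) := by
    refine Real.le_sqrt_of_sq_le ?_
    -- The defect is a perfect square up to the factor `1/3`: on the zero-sum plane the form has
    -- eigenvalues `w₀ + w₁ + w₂ ± √Q`.
    have : Q * N ^ 2 - ((w₀ + w₁ + w₂) * N - A) ^ 2 =
        (w₀ * ((a - b) ^ 2 - (b - (-a - b)) ^ 2) + w₁ * ((b - (-a - b)) ^ 2 - (-a - b - a) ^ 2) +
          w₂ * ((-a - b - a) ^ 2 - (a - b) ^ 2)) ^ 2 / 3 := by
      rw [hQ, hN, hA]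
      ring
    linarith [div_nonneg (sq_nonneg (w₀ * ((a - b) ^ 2 - (b - (-a - b)) ^ 2) +
      w₁ * ((b - (-a - b)) ^ 2 - (-a - b - a) ^ 2) +
      w₂ * ((-a - b - a) ^ 2 - (a - b) ^ 2))) (zero_le_three (α := ℝ))]
  rw [Real.sqrt_mul hQ0, Real.sqrt_sq hN0] at key
  linarith

theorem misorient_sub_orientInf (α α₀ : Orient) (j : Fin 3) :
    misorient (α - orientInf α₀) j = misorient α j := by
  simp [misorient, orientInf]

theorem misorient_zero (j : Fin 3) : misorient 0 j = 0 := by simp [misorient]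

theorem misorient_smul (s : ℝ) (u : Orient) (j : Fin 3) :
    misorient (s • u) j = s * misorient u j := by
  simp [misorient]; ring

theorem rateOne_mul_norm_sq_le (x : Fin 3 → Plane) (aInf : Plane) {u : Orient}
    (hu : ∑ j, u j = 0) :
    rateOne x aInf * ‖u‖ ^ 2 ≤ ∑ j, ‖x j - aInf‖ * misorient u j ^ 2 := by
  rw [EuclideanSpace.norm_sq_eq]
  simp only [Fin.sum_univ_three, misorient, rateOne, Real.norm_eq_abs, sq_abs] at hu ⊢
  exact triangle_form_ge hu

/-- The square of the sum of the three lengths exceeds the radicand by three times the sum of their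
pairwise products. -/
theorem rateOne_pos {x : Fin 3 → Plane} {aInf : Plane} (h : ∀ j, x j - aInf ≠ 0) :
    0 < rateOne x aInf := by
  have h0 := norm_pos_iff.2 (h 0)
  have h1 := norm_pos_iff.2 (h 1)
  have h2 := norm_pos_iff.2 (h 2)
  simp only [rateOne, Fin.sum_univ_three, sub_pos]
  rw [Real.sqrt_lt' (by positivity)]
  simp only [zero_add, show (1 : Fin 3) + 1 = 2 from rfl, show (2 : Fin 3) + 1 = 0 from rfl]
  nlinarith [mul_pos h0 h1, mul_pos h1 h2, mul_pos h2 h0]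

theorem norm_unit {v : Plane} (hv : v ≠ 0) : ‖unit v‖ = 1 := by
  rw [unit, norm_smul, norm_inv, norm_norm, inv_mul_cancel₀ (norm_ne_zero_iff.2 hv)]

theorem junctionOp_apply (x : Fin 3 → Plane) (aInf v : Plane) :
    junctionOp x aInf v = ∑ j, ‖x j - aInf‖⁻¹ •
      (v - ⟪unit (x j - aInf), v⟫ • unit (x j - aInf)) := by
  simp [junctionOp]

theorem inner_junctionOp (x : Fin 3 → Plane) (aInf v w : Plane) :
    ⟪junctionOp x aInf v, w⟫ = ∑ j, ‖x j - aInf‖⁻¹ *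
      (⟪v, w⟫ - ⟪unit (x j - aInf), v⟫ * ⟪unit (x j - aInf), w⟫) := by
  simp only [junctionOp_apply, sum_inner, real_inner_smul_left, inner_sub_left]

theorem junctionOp_isSymmetric (x : Fin 3 → Plane) (aInf : Plane) :
    (junctionOp x aInf).IsSymmetric := by
  intro v w
  rw [real_inner_comm (junctionOp x aInf w), inner_junctionOp, inner_junctionOp]
  refine Finset.sum_congr rfl fun j _ => ?_
  rw [real_inner_comm v w]
  ring

theorem inner_unit_sq_le {b : Plane} (hb : b ≠ 0) (v : Plane) :
    ⟪unit b, v⟫ * ⟪unit b, v⟫ ≤ ⟪v, v⟫ := by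
  have := real_inner_mul_inner_self_le (unit b) v
  rwa [real_inner_self_eq_norm_sq (unit b), norm_unit hb, one_pow, one_mul] at this

/-- Each summand is nonnegative by Cauchy–Schwarz. If all vanished, the components of `v` along the
three unit vectors would all be `±‖v‖`, and three such numbers cannot sum to zero. -/
theorem inner_junctionOp_self_pos {x : Fin 3 → Plane} {aInf : Plane} (h : IsEquilibrium x aInf)
    {v : Plane} (hv : v ≠ 0) : 0 < ⟪junctionOp x aInf v, v⟫ := by
  rw [inner_junctionOp]
  have hnn : ∀ j, 0 ≤ ‖x j - aInf‖⁻¹ *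
      (⟪v, v⟫ - ⟪unit (x j - aInf), v⟫ * ⟪unit (x j - aInf), v⟫) := fun j =>
    mul_nonneg (by positivity) (sub_nonneg.2 (inner_unit_sq_le (h.1 j) v))
  refine (Finset.sum_nonneg fun j _ => hnn j).lt_of_ne' fun h0 => ?_
  rw [Finset.sum_eq_zero_iff_of_nonneg fun j _ => hnn j] at h0
  have hsq : ∀ j, ⟪unit (x j - aInf), v⟫ * ⟪unit (x j - aInf), v⟫ = ⟪v, v⟫ := fun j => by
    have := (mul_eq_zero.1 (h0 j (Finset.mem_univ j))).resolve_left
      (inv_ne_zero (norm_ne_zero_iff.2 (h.1 j)))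
    linarith
  have hsum : ∑ j, ⟪unit (x j - aInf), v⟫ = 0 := by rw [← sum_inner, h.2, inner_zero_left]
  have hpos : 0 < ⟪v, v⟫ := real_inner_self_pos.2 hv
  have e0 := hsq 0
  have e1 := hsq 1
  have e2 := hsq 2
  rw [Fin.sum_univ_three] at hsum
  set p := ⟪unit (x 0 - aInf), v⟫
  set q := ⟪unit (x 1 - aInf), v⟫
  have hr : ⟪unit (x 2 - aInf), v⟫ = -p - q := by linarith
  rw [hr] at e2
  have : p * q = -⟪v, v⟫ / 2 := by linarith
  nlinarith [congrArg (fun t => t ^ 2) this, congrArg₂ (· * ·) e0 e1]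

/-- A symmetric operator on the plane has an eigenvalue, and only finitely many, so the infimum is
attained. -/
theorem rateTwo_mem (x : Fin 3 → Plane) (aInf : Plane) :
    Module.End.HasEigenvalue (junctionOp x aInf) (rateTwo x aInf) := by
  have hfin : {μ : ℝ | Module.End.HasEigenvalue (junctionOp x aInf) μ}.Finite :=
    Module.End.finite_hasEigenvalue _
  exact Set.Nonempty.csInf_mem
    ⟨_, (junctionOp_isSymmetric x aInf).hasEigenvalue_iInf_of_finiteDimensional⟩ hfin

theorem rateTwo_pos {x : Fin 3 → Plane} {aInf : Plane} (h : IsEquilibrium x aInf) :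
    0 < rateTwo x aInf := by
  obtain ⟨v, hv⟩ := (rateTwo_mem x aInf).exists_hasEigenvector
  have h1 := inner_junctionOp_self_pos h hv.2
  rw [hv.apply_eq_smul, real_inner_smul_left] at h1
  exact pos_of_mul_pos_left h1 real_inner_self_nonneg

/-- The infimum of the Rayleigh quotient is itself an eigenvalue, hence at least `rateTwo`. -/
theorem rateTwo_mul_norm_sq_le {x : Fin 3 → Plane} {aInf : Plane} (h : IsEquilibrium x aInf)
    (v : Plane) : rateTwo x aInf * ‖v‖ ^ 2 ≤ ⟪junctionOp x aInf v, v⟫ := by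
  rcases eq_or_ne v 0 with rfl | hv
  · simp
  have hfin : {μ : ℝ | Module.End.HasEigenvalue (junctionOp x aInf) μ}.Finite :=
    Module.End.finite_hasEigenvalue _
  have h1 : rateTwo x aInf ≤ _ := csInf_le hfin.bddBelow
    (junctionOp_isSymmetric x aInf).hasEigenvalue_iInf_of_finiteDimensional
  have hbdd : BddBelow (range fun w : {w : Plane // w ≠ 0} =>
      RCLike.re ⟪junctionOp x aInf w, (w : Plane)⟫ / ‖(w : Plane)‖ ^ 2) := by
    refine ⟨0, ?_⟩
    rintro _ ⟨w, rfl⟩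
    exact div_nonneg (inner_junctionOp_self_pos h w.2).le (by positivity)
  have h2 := h1.trans (ciInf_le hbdd ⟨v, hv⟩)
  rwa [le_div_iff₀ (by positivity)] at h2

/-! ### The vector field and its linearization -/

/-- The vector field of the whole system. -/
noncomputable def field (σ : ℝ → ℝ) (γ η : ℝ) (x : Fin 3 → Plane) (z : Orient × Plane) :
    Orient × Plane :=
  (orientField σ γ x z.1 z.2, junctionField σ η x z.1 z.2)

theorem IsSurfaceTension.deriv_zero {σ : ℝ → ℝ} (hσ : IsSurfaceTension σ) : deriv σ 0 = 0 :=
  (hσ.deriv_eq_zero_iff 0).2 rfl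

theorem IsSurfaceTension.contDiff_deriv {σ : ℝ → ℝ} (hσ : IsSurfaceTension σ) :
    ContDiff ℝ 2 (deriv σ) :=
  hσ.contDiff.iterate_deriv' 2 1

theorem sum_orientField (σ : ℝ → ℝ) (γ : ℝ) (x : Fin 3 → Plane) (α : Orient) (a : Plane) :
    ∑ j, orientField σ γ x α a j = 0 := by
  simp only [orientField, Fin.sum_univ_three, zero_add, show (1 : Fin 3) + 1 = 2 from rfl,
    show (2 : Fin 3) + 1 = 0 from rfl]
  ring

theorem orientField_sub_orientInf (σ : ℝ → ℝ) (γ : ℝ) (x : Fin 3 → Plane) (α α₀ : Orient)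
    (a : Plane) : orientField σ γ x (α - orientInf α₀) a = orientField σ γ x α a := by
  simp only [orientField, misorient_sub_orientInf]

theorem junctionField_sub_orientInf (σ : ℝ → ℝ) (η : ℝ) (x : Fin 3 → Plane) (α α₀ : Orient)
    (a : Plane) : junctionField σ η x (α - orientInf α₀) a = junctionField σ η x α a := by
  simp only [junctionField, misorient_sub_orientInf]

theorem energy_sub_orientInf (σ : ℝ → ℝ) (x : Fin 3 → Plane) (α α₀ : Orient)
    (a : Plane) : energy σ x (α - orientInf α₀) a = energy σ x α a := by
  simp only [energy, misorient_sub_orientInf]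

theorem energy_zero (σ : ℝ → ℝ) (x : Fin 3 → Plane) (a : Plane) :
    energy σ x 0 a = energyInf σ x a := by
  simp only [energy, energyInf, misorient_zero, Finset.mul_sum]

theorem sum_sub_orientInf (α₀ : Orient) : ∑ j, (α₀ - orientInf α₀) j = 0 := by
  simp [orientInf, Fin.sum_univ_three]; ring

theorem field_equilibrium {σ : ℝ → ℝ} (hσ : IsSurfaceTension σ) (γ η : ℝ) {x : Fin 3 → Plane}
    {aInf : Plane} (h : IsEquilibrium x aInf) : field σ γ η x (0, aInf) = 0 := by
  refine Prod.ext ?_ ?_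
  · ext j
    simp [field, orientField, misorient_zero, hσ.deriv_zero]
  · simp [field, junctionField, misorient_zero, ← Finset.smul_sum, h.2]

theorem contDiff_misorient (j : Fin 3) :
    ContDiff ℝ 2 (fun z : Orient × Plane => misorient z.1 j) := by
  unfold misorient
  fun_prop

theorem contDiffAt_norm_sub (x a : Plane) (h : x - a ≠ 0) (α : Orient) :
    ContDiffAt ℝ 2 (fun z : Orient × Plane => ‖x - z.2‖) (α, a) :=
  (contDiffAt_const.sub contDiffAt_snd).norm ℝ h

theorem contDiffAt_field {σ : ℝ → ℝ} (hσ : IsSurfaceTension σ) (γ η : ℝ) {x : Fin 3 → Plane}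
    {a : Plane} (h : ∀ j, x j - a ≠ 0) (α : Orient) : ContDiffAt ℝ 2 (field σ γ η x) (α, a) := by
  refine ContDiffAt.prodMk ?_ ?_
  · refine contDiffAt_euclidean.2 fun j => ?_
    have hterm : ∀ j, ContDiffAt ℝ 2
        (fun z : Orient × Plane => deriv σ (misorient z.1 j) * ‖x j - z.2‖) (α, a) := fun j =>
      (hσ.contDiff_deriv.comp (contDiff_misorient j)).contDiffAt.mul
        (contDiffAt_norm_sub _ _ (h j) α)
    exact contDiffAt_const.mul ((hterm (j + 1)).sub (hterm j))
  · have hterm : ∀ j, ContDiffAt ℝ 2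
        (fun z : Orient × Plane => σ (misorient z.1 j) • unit (x j - z.2)) (α, a) := fun j =>
      ((hσ.contDiff.of_le (m := 2) (by norm_num)).comp
        (contDiff_misorient j)).contDiffAt.smul
        (((contDiffAt_norm_sub _ _ (h j) α).inv (norm_ne_zero_iff.2 (h j))).smul
          (contDiffAt_const.sub contDiffAt_snd))
    exact (contDiffAt_const (c := η)).smul (ContDiffAt.sum fun j _ => hterm j)

theorem contDiffAt_energy {σ : ℝ → ℝ} (hσ : IsSurfaceTension σ) {x : Fin 3 → Plane}
    {a : Plane} (h : ∀ j, x j - a ≠ 0) (α : Orient) :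
    ContDiffAt ℝ 2 (fun z : Orient × Plane => energy σ x z.1 z.2) (α, a) :=
  ContDiffAt.sum fun j _ =>
    ((hσ.contDiff.of_le (by norm_num)).comp (contDiff_misorient j)).contDiffAt.mul
      (contDiffAt_norm_sub _ _ (h j) α)

theorem hasDerivAt_norm_sub_smul {b : Plane} (hb : b ≠ 0) (v : Plane) :
    HasDerivAt (fun s : ℝ => ‖b - s • v‖) (-⟪unit b, v⟫) 0 := by
  have h1 : HasDerivAt (fun s : ℝ => b - s • v) (-v) 0 := by
    simpa using ((hasDerivAt_id (0 : ℝ)).smul_const v).const_sub b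
  have h2 := h1.norm_sq.sqrt (by simpa using hb)
  simp only [Real.sqrt_sq (norm_nonneg _)] at h2
  convert h2 using 1
  simp only [zero_smul, sub_zero, inner_neg_right, unit, real_inner_smul_left]
  have := norm_ne_zero_iff.2 hb
  field_simp

theorem hasDerivAt_unit_sub_smul {b : Plane} (hb : b ≠ 0) (v : Plane) :
    HasDerivAt (fun s : ℝ => unit (b - s • v)) (-(‖b‖⁻¹ • (v - ⟪unit b, v⟫ • unit b))) 0 := by
  have h1 : HasDerivAt (fun s : ℝ => b - s • v) (-v) 0 := by
    simpa using ((hasDerivAt_id (0 : ℝ)).smul_const v).const_sub b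
  have hb' := norm_ne_zero_iff.2 hb
  have h2 := ((hasDerivAt_norm_sub_smul hb v).inv (by simpa using hb)).smul h1
  convert! h2 using 1
  simp only [zero_smul, sub_zero, unit, smul_sub, smul_neg, smul_smul, neg_neg, Pi.inv_apply]
  rw [neg_sub, sub_eq_neg_add]
  congr 2
  field_simp

/-- The two blocks decouple because every mixed term carries the factor `σ'(0) = 0`. -/
theorem hasDerivAt_field_line {σ : ℝ → ℝ} (hσ : IsSurfaceTension σ) (γ η : ℝ)
    {x : Fin 3 → Plane} {aInf : Plane} (h : IsEquilibrium x aInf) (u : Orient) (v : Plane) :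
    HasDerivAt (fun s : ℝ => field σ γ η x (s • u, aInf + s • v))
      (WithLp.toLp 2 fun j => -γ * (deriv (deriv σ) 0 *
        (misorient u (j + 1) * ‖x (j + 1) - aInf‖ - misorient u j * ‖x j - aInf‖)),
        -(η * σ 0) • junctionOp x aInf v) 0 := by
  have hm : ∀ j, HasDerivAt (fun s : ℝ => misorient (s • u) j) (misorient u j) 0 := fun j => by
    simp only [misorient_smul]
    simpa using (hasDerivAt_id (0 : ℝ)).mul_const (misorient u j)
  have hb : ∀ j (s : ℝ), x j - (aInf + s • v) = x j - aInf - s • v := fun j s => by abel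
  refine HasDerivAt.prodMk ?_ ?_
  · have hterm : ∀ j, HasDerivAt
        (fun s : ℝ => deriv σ (misorient (s • u) j) * ‖x j - (aInf + s • v)‖)
        (deriv (deriv σ) 0 * misorient u j * ‖x j - aInf‖) 0 := fun j => by
      have h1 : HasDerivAt (deriv σ) (deriv (deriv σ) 0) (misorient ((0 : ℝ) • u) j) := by
        rw [zero_smul, misorient_zero]
        exact (hσ.contDiff_deriv.differentiable (by simp) 0).hasDerivAt
      simp only [hb]
      convert! (h1.comp (0 : ℝ) (hm j)).mul (hasDerivAt_norm_sub_smul (h.1 j) v) using 1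
      simp [misorient_zero, hσ.deriv_zero]
    refine HasFDerivAt.comp_hasDerivAt (0 : ℝ) (PiLp.hasFDerivAt_toLp 2 _)
      (f := fun (s : ℝ) (j : Fin 3) =>
        -γ * (deriv σ (misorient (s • u) (j + 1)) * ‖x (j + 1) - (aInf + s • v)‖
          - deriv σ (misorient (s • u) j) * ‖x j - (aInf + s • v)‖))
      (hasDerivAt_pi.2 fun j => ?_)
    convert! ((hterm (j + 1)).sub (hterm j)).const_mul (-γ) using 1
    ring
  · have hterm : ∀ j, HasDerivAt
        (fun s : ℝ => σ (misorient (s • u) j) • unit (x j - (aInf + s • v)))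
        (σ 0 • -(‖x j - aInf‖⁻¹ •
          (v - ⟪unit (x j - aInf), v⟫ • unit (x j - aInf)))) 0 := fun j => by
      have h1 : HasDerivAt σ (deriv σ 0) (misorient ((0 : ℝ) • u) j) := by
        rw [zero_smul, misorient_zero]
        exact (hσ.contDiff.differentiable (by simp) 0).hasDerivAt
      simp only [hb]
      convert! (h1.comp (0 : ℝ) (hm j)).smul (hasDerivAt_unit_sub_smul (h.1 j) v) using 1
      simp [misorient_zero, hσ.deriv_zero]
    convert! (HasDerivAt.fun_sum (u := Finset.univ) fun j _ => hterm j).const_smul η using 1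
    rw [junctionOp_apply]
    simp only [smul_neg, Finset.sum_neg_distrib, ← Finset.smul_sum, mul_smul, neg_smul]

/-- The linearization at the equilibrium is dissipative with rate `rate`. -/
theorem inner_fderiv_field_le {σ : ℝ → ℝ} (hσ : IsSurfaceTension σ) {γ η : ℝ} (hγ : 0 < γ)
    (hη : 0 < η) {x : Fin 3 → Plane} {aInf : Plane} (h : IsEquilibrium x aInf) {u : Orient}
    (hu : ∑ j, u j = 0) (v : Plane) :
    ⟪(fderiv ℝ (field σ γ η x) (0, aInf) (u, v)).1, u⟫ +
        ⟪(fderiv ℝ (field σ γ η x) (0, aInf) (u, v)).2, v⟫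
      ≤ -rate σ γ η x aInf * (‖u‖ ^ 2 + ‖v‖ ^ 2) := by
  have hline : HasDerivAt (fun s : ℝ => ((s • u, aInf + s • v) : Orient × Plane)) (u, v) 0 := by
    refine HasDerivAt.prodMk ?_ ?_
    · simpa using (hasDerivAt_id (0 : ℝ)).smul_const u
    · simpa using ((hasDerivAt_id (0 : ℝ)).smul_const v).const_add aInf
  have hd : HasFDerivAt (field σ γ η x) (fderiv ℝ (field σ γ η x) (0, aInf))
      ((0 : ℝ) • u, aInf + (0 : ℝ) • v) := by
    simpa using ((contDiffAt_field hσ γ η h.1 0).differentiableAt (by simp)).hasFDerivAt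
  rw [HasDerivAt.unique (hd.comp_hasDerivAt (0 : ℝ) hline)
    (f := field σ γ η x ∘ fun s : ℝ => (s • u, aInf + s • v)) (hasDerivAt_field_line hσ γ η h u v)]
  -- Cyclic summation by parts.
  have h1 : ⟪(WithLp.toLp 2 fun j => -γ * (deriv (deriv σ) 0 *
      (misorient u (j + 1) * ‖x (j + 1) - aInf‖ - misorient u j * ‖x j - aInf‖)) : Orient), u⟫ =
      -(γ * deriv (deriv σ) 0) * ∑ j, ‖x j - aInf‖ * misorient u j ^ 2 := by
    simp only [PiLp.inner_apply, Fin.sum_univ_three, misorient, zero_add,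
      show (1 : Fin 3) + 1 = 2 from rfl, show (2 : Fin 3) + 1 = 0 from rfl,
      show (0 : Fin 3) - 1 = 2 from rfl, show (1 : Fin 3) - 1 = 0 from rfl,
      show (2 : Fin 3) - 1 = 1 from rfl, RCLike.inner_apply, conj_trivial]
    ring
  have h2 := mul_le_mul_of_nonneg_left (rateOne_mul_norm_sq_le x aInf hu)
    (mul_pos hγ hσ.deriv2_pos).le
  have h3 := mul_le_mul_of_nonneg_left (rateTwo_mul_norm_sq_le h v) (mul_pos hη hσ.zero_pos).le
  have h4 := mul_le_mul_of_nonneg_right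
    (min_le_left (γ * deriv (deriv σ) 0 * rateOne x aInf) (η * σ 0 * rateTwo x aInf))
    (sq_nonneg ‖u‖)
  have h5 := mul_le_mul_of_nonneg_right
    (min_le_right (γ * deriv (deriv σ) 0 * rateOne x aInf) (η * σ 0 * rateTwo x aInf))
    (sq_nonneg ‖v‖)
  dsimp only
  rw [h1, real_inner_smul_left, rate]
  linarith

theorem rate_pos {σ : ℝ → ℝ} (hσ : IsSurfaceTension σ) {γ η : ℝ} (hγ : 0 < γ)
    (hη : 0 < η) {x : Fin 3 → Plane} {aInf : Plane} (h : IsEquilibrium x aInf) :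
    0 < rate σ γ η x aInf :=
  lt_min (mul_pos (mul_pos hγ hσ.deriv2_pos) (rateOne_pos h.1))
    (mul_pos (mul_pos hη hσ.zero_pos) (rateTwo_pos h))

/-! ### Lyapunov function and decay near the equilibrium -/

/-- The squared Euclidean distance of `z` to the equilibrium `(0, aInf)`. -/
noncomputable def sqDist (aInf : Plane) (z : Orient × Plane) : ℝ :=
  ‖z.1‖ ^ 2 + ‖z.2 - aInf‖ ^ 2

theorem sqDist_nonneg (aInf : Plane) (z : Orient × Plane) : 0 ≤ sqDist aInf z := by
  unfold sqDist
  positivity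

theorem norm_fst_le_sqrt_sqDist (aInf : Plane) (z : Orient × Plane) :
    ‖z.1‖ ≤ √(sqDist aInf z) :=
  Real.le_sqrt_of_sq_le (le_add_of_nonneg_right (sq_nonneg _))

theorem norm_snd_sub_le_sqrt_sqDist (aInf : Plane) (z : Orient × Plane) :
    ‖z.2 - aInf‖ ≤ √(sqDist aInf z) :=
  Real.le_sqrt_of_sq_le (le_add_of_nonneg_left (sq_nonneg _))

/-- The product carries the maximum norm, so the two component bounds suffice. -/
theorem norm_sub_le_sqrt_sqDist (aInf : Plane) (z : Orient × Plane) :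
    ‖z - (0, aInf)‖ ≤ √(sqDist aInf z) := by
  refine max_le ?_ (norm_snd_sub_le_sqrt_sqDist aInf z)
  simpa using norm_fst_le_sqrt_sqDist aInf z

theorem sqDist_le_sq (aInf : Plane) (z : Orient × Plane) :
    sqDist aInf z ≤ (‖z.1‖ + ‖z.2 - aInf‖) ^ 2 := by
  unfold sqDist
  nlinarith [norm_nonneg z.1, norm_nonneg (z.2 - aInf)]

/-- Near the equilibrium the squared distance is a Lyapunov function. -/
theorem exists_inner_field_le {σ : ℝ → ℝ} (hσ : IsSurfaceTension σ) {γ η : ℝ} (hγ : 0 < γ)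
    (hη : 0 < η) {x : Fin 3 → Plane} {aInf : Plane} (h : IsEquilibrium x aInf) :
    ∃ K : ℝ, 0 ≤ K ∧ ∀ᶠ z : Orient × Plane in 𝓝 (0, aInf), ∑ j, z.1 j = 0 →
      ⟪(field σ γ η x z).1, z.1⟫ + ⟪(field σ γ η x z).2, z.2 - aInf⟫ ≤
        -rate σ γ η x aInf * sqDist aInf z + 2 * K * (sqDist aInf z * √(sqDist aInf z)) := by
  obtain ⟨K, hK, hev⟩ := (contDiffAt_field hσ γ η h.1 0).exists_norm_sub_sub_fderiv_le
  refine ⟨K, hK, hev.mono fun z hz hsum => ?_⟩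
  rw [field_equilibrium hσ γ η h, sub_zero] at hz
  have hzp : z - (0, aInf) = (z.1, z.2 - aInf) := Prod.ext (sub_zero _) rfl
  have hlin := inner_fderiv_field_le hσ hγ hη h hsum (z.2 - aInf)
  rw [← hzp] at hlin
  set A := fderiv ℝ (field σ γ η x) (0, aInf) (z - (0, aInf))
  have hR : K * ‖z - (0, aInf)‖ ^ 2 ≤ K * sqDist aInf z := by
    refine mul_le_mul_of_nonneg_left ?_ hK
    calc _ ≤ √(sqDist aInf z) ^ 2 := by gcongr; exact norm_sub_le_sqrt_sqDist aInf z
      _ = _ := Real.sq_sqrt (sqDist_nonneg aInf z)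
  have hy := sqDist_nonneg aInf z
  have h1 : ⟪(field σ γ η x z).1 - A.1, z.1⟫ ≤ K * sqDist aInf z * √(sqDist aInf z) :=
    (real_inner_le_norm _ _).trans (mul_le_mul
      ((norm_fst_le (field σ γ η x z - A)).trans (hz.trans hR))
      (norm_fst_le_sqrt_sqDist aInf z) (norm_nonneg _) (by positivity))
  have h2 : ⟪(field σ γ η x z).2 - A.2, z.2 - aInf⟫ ≤ K * sqDist aInf z * √(sqDist aInf z) :=
    (real_inner_le_norm _ _).trans (mul_le_mul
      ((norm_snd_le (field σ γ η x z - A)).trans (hz.trans hR))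
      (norm_snd_sub_le_sqrt_sqDist aInf z) (norm_nonneg _) (by positivity))
  rw [inner_sub_left] at h1 h2
  have h3 : ‖z.1‖ ^ 2 + ‖z.2 - aInf‖ ^ 2 = sqDist aInf z := rfl
  rw [h3] at hlin
  linarith

/-- The sum of the orientations is conserved. -/
theorem sum_orient_eq_zero {σ : ℝ → ℝ} {γ η : ℝ} {x : Fin 3 → Plane} {χ : Orient × Plane → ℝ}
    {z : ℝ → Orient × Plane} (hz : ContinuousOn z (Ici 0))
    (hd : ∀ t, 0 < t → HasDerivAt z (χ (z t) • field σ γ η x (z t)) t)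
    (h0 : ∑ j, (z 0).1 j = 0) {t : ℝ} (ht : 0 ≤ t) : ∑ j, (z t).1 j = 0 := by
  let S : Orient × Plane →L[ℝ] ℝ :=
    (∑ j : Fin 3, EuclideanSpace.proj j).comp (ContinuousLinearMap.fst ℝ Orient Plane)
  have hS : ∀ w, S w = ∑ j, w.1 j := fun w => by simp [S]
  have hSF : ∀ w, S (field σ γ η x w) = 0 := fun w => by
    rw [hS]
    exact sum_orientField σ γ x w.1 w.2
  have hder : ∀ s, 0 < s → HasDerivAt (fun s => S (z s)) 0 s := fun s hs => by
    have := S.hasFDerivAt.comp_hasDerivAt s (hd s hs)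
    rwa [map_smul, hSF, smul_zero] at this
  have hcont : ContinuousOn (fun s => S (z s)) (Ici 0) := S.continuous.comp_continuousOn hz
  -- With zero weight, both the sum and its negative are nonincreasing.
  have h1 := mul_exp_le_of_deriv_le (g := fun _ => 0) (g' := fun _ => 0) hcont hder
    (fun s => hasDerivAt_const s 0) (fun s _ => by simp) ht
  have h2 := mul_exp_le_of_deriv_le (g := fun _ => 0) (g' := fun _ => 0) hcont.neg
    (fun s hs => (hder s hs).neg) (fun s => hasDerivAt_const s 0) (fun s _ => by simp) ht
  simp only [Real.exp_zero, mul_one, hS, h0, Pi.neg_apply] at h1 h2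
  linarith

/-- Solutions that start near the equilibrium stay near it and decay with the linear rate, also
for the field cut off away from the equilibrium. -/
theorem sqDist_decay {σ : ℝ → ℝ} {γ η : ℝ} {x : Fin 3 → Plane} {aInf : Plane}
    {χ : Orient × Plane → ℝ} {r K δ : ℝ}
    (hχ : ∀ z ∈ Metric.closedBall ((0, aInf) : Orient × Plane) r, χ z = 1) (hK : 0 ≤ K)
    (hrate : 0 < rate σ γ η x aInf)
    (hF : ∀ z ∈ Metric.closedBall ((0, aInf) : Orient × Plane) r, ∑ j, z.1 j = 0 →
      ⟪(field σ γ η x z).1, z.1⟫ + ⟪(field σ γ η x z).2, z.2 - aInf⟫ ≤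
        -rate σ γ η x aInf * sqDist aInf z + 2 * K * (sqDist aInf z * √(sqDist aInf z)))
    (hδ : 0 < δ) (hδr : √δ ≤ r) (hδK : 2 * K * √δ ≤ rate σ γ η x aInf / 2)
    {z : ℝ → Orient × Plane} (hz : ContinuousOn z (Ici 0))
    (hd : ∀ t, 0 < t → HasDerivAt z (χ (z t) • field σ γ η x (z t)) t)
    (hsum : ∑ j, (z 0).1 j = 0) (h0 : sqDist aInf (z 0) < δ) {t : ℝ} (ht : 0 ≤ t) :
    z t ∈ Metric.closedBall ((0, aInf) : Orient × Plane) r ∧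
      sqDist aInf (z t) ≤ δ * Real.exp (4 * (2 * K) * √δ / rate σ γ η x aInf) *
        Real.exp (-2 * rate σ γ η x aInf * t) := by
  have hball : ∀ w, sqDist aInf w ≤ δ → w ∈ Metric.closedBall ((0, aInf) : Orient × Plane) r :=
    fun w hw => by
      rw [Metric.mem_closedBall, dist_eq_norm]
      exact (norm_sub_le_sqrt_sqDist aInf w).trans ((Real.sqrt_le_sqrt hw).trans hδr)
  have hcont : ContinuousOn (fun s => sqDist aInf (z s)) (Ici 0) := by
    unfold sqDist
    fun_prop
  have hder : ∀ s, 0 < s → HasDerivAt (fun s => sqDist aInf (z s))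
      (2 * ⟪(z s).1, (χ (z s) • field σ γ η x (z s)).1⟫ +
        2 * ⟪(z s).2 - aInf, (χ (z s) • field σ γ η x (z s)).2⟫) s := fun s hs => by
    have h1 : HasDerivAt (fun s => (z s).1) (χ (z s) • field σ γ η x (z s)).1 s :=
      (ContinuousLinearMap.fst ℝ Orient Plane).hasFDerivAt.comp_hasDerivAt s (hd s hs)
    have h2 : HasDerivAt (fun s => (z s).2) (χ (z s) • field σ γ η x (z s)).2 s :=
      (ContinuousLinearMap.snd ℝ Orient Plane).hasFDerivAt.comp_hasDerivAt s (hd s hs)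
    exact h1.norm_sq.add (h2.sub_const aInf).norm_sq
  have := exp_decay_of_deriv_le (K := 2 * K) hcont (fun s _ => sqDist_nonneg aInf (z s)) hder hrate
    (by positivity) hδ hδK (fun s hs hsδ => by
      have h1 := hF (z s) (hball _ hsδ) (sum_orient_eq_zero hz hd hsum hs.le)
      rw [hχ (z s) (hball _ hsδ), one_smul, real_inner_comm, real_inner_comm _ ((z s).2 - aInf)]
      linarith) h0 ht
  exact ⟨hball _ this.1, this.2⟩

/-- The energy is Lipschitz at the equilibrium. -/
theorem exists_energy_sub_le {σ : ℝ → ℝ} (hσ : IsSurfaceTension σ) {x : Fin 3 → Plane}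
    {aInf : Plane} (h : IsEquilibrium x aInf) :
    ∃ M > 0, ∀ᶠ z : Orient × Plane in 𝓝 (0, aInf),
      energy σ x z.1 z.2 - energyInf σ x aInf ≤ M * √(sqDist aInf z) := by
  obtain ⟨M, hM, hev⟩ := ((contDiffAt_energy hσ h.1 0).differentiableAt
    (by simp)).isBigO_sub.exists_pos
  refine ⟨M, hM, hev.bound.mono fun z hz => ?_⟩
  rw [energy_zero] at hz
  exact (Real.le_norm_self _).trans
    (hz.trans (mul_le_mul_of_nonneg_left (norm_sub_le_sqrt_sqDist aInf z) hM.le))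

/-- Subtracting the mean orientation turns a global solution into one of the reduced system. -/
theorem IsGlobalSolution.reduced {σ : ℝ → ℝ} {γ η : ℝ} {x : Fin 3 → Plane} {α₀ : Orient}
    {a₀ : Plane} {α : ℝ → Orient} {a : ℝ → Plane} (h : IsGlobalSolution σ γ η x α₀ a₀ α a) :
    ContinuousOn (fun t => (α t - orientInf α₀, a t)) (Ici 0) ∧
      ∀ t, 0 < t → HasDerivAt (fun t => (α t - orientInf α₀, a t))
        (field σ γ η x (α t - orientInf α₀, a t)) t := by
  refine ⟨(h.cont_orient.sub continuousOn_const).prodMk h.cont_junction, fun t ht => ?_⟩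
  have := ((h.eq_orient t ht).sub_const (orientInf α₀)).prodMk (h.eq_junction t ht)
  simpa only [field, orientField_sub_orientInf, junctionField_sub_orientInf] using this

end GrainBoundary

/-! ### Existence, uniqueness and decay -/

open GrainBoundary

theorem mainTheorem4 (σ : ℝ → ℝ) (hσ : GrainBoundary.IsSurfaceTension σ)
    (γ η : ℝ) (hγ : 0 < γ) (hη : 0 < η)
    (x : Fin 3 → GrainBoundary.Plane) (hx : GrainBoundary.AngleCondition x)
    (aInf : GrainBoundary.Plane) (haInf : GrainBoundary.IsEquilibrium x aInf) :
    ∃ ε C C' rateStar : ℝ, 0 < ε ∧ 0 < C ∧ 0 < C' ∧ 0 < rateStar ∧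
      GrainBoundary.rate σ γ η x aInf ≤ rateStar ∧
      ∀ (α₀ : GrainBoundary.Orient) (a₀ : GrainBoundary.Plane),
        ‖α₀ - GrainBoundary.orientInf α₀‖ + ‖a₀ - aInf‖ < ε →
        ∃ (α : ℝ → GrainBoundary.Orient) (a : ℝ → GrainBoundary.Plane),
          GrainBoundary.IsGlobalSolution σ γ η x α₀ a₀ α a ∧
          (∀ (β : ℝ → GrainBoundary.Orient) (b : ℝ → GrainBoundary.Plane),
            GrainBoundary.IsGlobalSolution σ γ η x α₀ a₀ β b →
              ∀ t, 0 ≤ t → β t = α t ∧ b t = a t) ∧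
          (∀ t, 0 ≤ t →
            ‖α t - GrainBoundary.orientInf α₀‖ + ‖a t - aInf‖ ≤ C * Real.exp (-rateStar * t)) ∧
          (∀ t, 0 ≤ t →
            GrainBoundary.energy σ x (α t) (a t) - GrainBoundary.energyInf σ x aInf
              ≤ C' * Real.exp (-rateStar * t)) := by
  have hrate := rate_pos hσ hγ hη haInf
  obtain ⟨K, hK, hlyap⟩ := exists_inner_field_le hσ hγ hη haInf
  obtain ⟨M, hM, henergy⟩ := exists_energy_sub_le hσ haInf
  obtain ⟨r₁, hr₁, χ, hχ, Kχ, Lχ, hlip, hbound⟩ :=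
    ((contDiffAt_field hσ γ η haInf.1 0).of_le (m := 1) (by norm_num)).exists_cutoff_smul
  have hne : ∀ᶠ z : Orient × Plane in 𝓝 (0, aInf), ∀ j, x j - z.2 ≠ 0 :=
    eventually_all.2 fun j => (continuousAt_const.sub continuousAt_snd).eventually_ne (haInf.1 j)
  obtain ⟨r₂, hr₂, hnear⟩ := Metric.nhds_basis_closedBall.eventually_iff.1
    ((hlyap.and henergy).and hne)
  obtain ⟨r, hr, hrr₁, hrr₂⟩ : ∃ r > 0, r ≤ r₁ ∧ r ≤ r₂ :=
    ⟨min r₁ r₂, lt_min hr₁ hr₂, min_le_left _ _, min_le_right _ _⟩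
  replace hχ : ∀ z ∈ Metric.closedBall ((0, aInf) : Orient × Plane) r, χ z = 1 := fun z hz =>
    hχ z (Metric.closedBall_subset_closedBall hrr₁ hz)
  replace hnear := fun z (hz : z ∈ Metric.closedBall ((0, aInf) : Orient × Plane) r) =>
    hnear (Metric.closedBall_subset_closedBall hrr₂ hz)
  set l := rate σ γ η x aInf with hl
  obtain ⟨e, he, her, heK⟩ : ∃ e > 0, e ≤ r ∧ 2 * K * e ≤ l / 2 := by
    refine ⟨min r (l / (4 * (K + 1))), lt_min hr (by positivity), min_le_left _ _, ?_⟩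
    calc 2 * K * min r (l / (4 * (K + 1))) ≤ 2 * (K + 1) * (l / (4 * (K + 1))) := by
          gcongr
          · linarith
          · exact min_le_right _ _
      _ = l / 2 := by field_simp; ring
  have hsqrt : √(e ^ 2) = e := Real.sqrt_sq he.le
  -- The cutoff is left free: the bump serves for existence, the constant `1` for an arbitrary
  -- solution of the original system.
  have hdecay := fun (χ : Orient × Plane → ℝ) hχ (z : ℝ → Orient × Plane) hz hd hsum h0
      (t : ℝ) ht =>
    sqDist_decay (δ := e ^ 2) (χ := χ) hχ hK hrate (fun z hz => (hnear z hz).1.1) (by positivity)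
      (hsqrt.trans_le her) (by rwa [hsqrt]) (z := z) hz hd hsum h0 (t := t) ht
  set B := e ^ 2 * Real.exp (4 * (2 * K) * √(e ^ 2) / rate σ γ η x aInf) with hB
  have hBpos : 0 < B := by positivity
  -- The factor `2` accounts for two norms, each at most `√B * exp (-l * t)`; `M` is the Lipschitz
  -- bound of the energy.
  refine ⟨e, 2 * √B, M * √B, l, he, by positivity, by positivity, hrate, le_rfl,
    fun α₀ a₀ h0 => ?_⟩
  have hinit : sqDist aInf (α₀ - orientInf α₀, a₀) < e ^ 2 :=
    (sqDist_le_sq _ _).trans_lt (pow_lt_pow_left₀ h0 (by positivity) two_ne_zero)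
  obtain ⟨z, hz0, hz⟩ :=
    exists_global_solution_of_lipschitzWith hlip hbound (α₀ - orientInf α₀, a₀)
  have hzc : ContinuousOn z (Ici 0) := fun t _ => (hz t).continuousAt.continuousWithinAt
  have hzd := hdecay χ hχ z hzc (fun t _ => hz t)
    (by rw [hz0]; exact sum_sub_orientInf α₀) (by rwa [hz0])
  have hzF : ∀ t, 0 ≤ t → HasDerivAt z (field σ γ η x (z t)) t := fun t ht => by
    have := hz t
    rwa [hχ _ (hzd t ht).1, one_smul] at this
  have hzsqrt : ∀ t, 0 ≤ t → √(sqDist aInf (z t)) ≤ √B * Real.exp (-l * t) := fun t ht => by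
    refine Real.sqrt_le_iff.2 ⟨by positivity, (hzd t ht).2.trans_eq ?_⟩
    rw [mul_pow, Real.sq_sqrt hBpos.le, ← Real.exp_nat_mul]
    congr 2
    push_cast
    ring
  refine ⟨fun t => (z t).1 + orientInf α₀, fun t => (z t).2, ?_, ?_, ?_, ?_⟩
  · refine ⟨by simp [hz0], by simp [hz0], by fun_prop, by fun_prop,
      fun t ht => (hnear _ (hzd t ht).1).2, fun t ht => ?_, fun t ht => ?_⟩
    · have : HasDerivAt (fun s => (z s).1) (field σ γ η x (z t)).1 t :=
        (ContinuousLinearMap.fst ℝ Orient Plane).hasFDerivAt.comp_hasDerivAt t (hzF t ht.le)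
      rw [← orientField_sub_orientInf σ γ x _ α₀, add_sub_cancel_right]
      exact this.add_const _
    · have : HasDerivAt (fun s => (z s).2) (field σ γ η x (z t)).2 t :=
        (ContinuousLinearMap.snd ℝ Orient Plane).hasFDerivAt.comp_hasDerivAt t (hzF t ht.le)
      rw [← junctionField_sub_orientInf σ η x _ α₀, add_sub_cancel_right]
      exact this
  · intro β b hsol t ht
    obtain ⟨hwc, hw⟩ := hsol.reduced
    have hw0 : (β 0 - orientInf α₀, b 0) = (α₀ - orientInf α₀, a₀) := by
      rw [hsol.init_orient, hsol.init_junction]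
    have hwd := hdecay (fun _ => 1) (fun _ _ => rfl) _ hwc
      (fun t ht => by simpa only [one_smul] using hw t ht)
      (by rw [hw0]; exact sum_sub_orientInf α₀) (by rwa [hw0])
    -- The competitor stays where the bump equals `1`, so it also solves the globally Lipschitz
    -- equation.
    have heq := eq_of_solution_of_lipschitzOnWith hlip.lipschitzOnWith hwc
      (fun t ht => by
        have := hw t ht
        rwa [← one_smul ℝ (field σ γ η x _), ← hχ _ (hwd t ht.le).1] at this)
      (fun _ _ => mem_univ _) hzc (fun t _ => hz t) (fun _ _ => mem_univ _) (hw0.trans hz0.symm)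
      hlip.continuous.continuousAt ht
    exact ⟨by simp [← heq], by simp [← heq]⟩
  · intro t ht
    have h1 := norm_fst_le_sqrt_sqDist aInf (z t)
    have h2 := norm_snd_sub_le_sqrt_sqDist aInf (z t)
    rw [add_sub_cancel_right]
    linarith [hzsqrt t ht]
  · intro t ht
    have h1 := (hnear _ (hzd t ht).1).1.2
    rw [← energy_sub_orientInf σ x _ α₀, add_sub_cancel_right, mul_assoc]
    exact h1.trans (mul_le_mul_of_nonneg_left (hzsqrt t ht) hM.le)
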